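/- Let $\partial\mathbb D=\{z\in\mathbb C:|z|=1\}$, let $\varphi:\partial\mathbb D\to\partial\mathbb D$ be continuous, and let $w:\partial\mathbb D\to\mathbb C$ be continuous with $|w(z)|=1$ for all $z\in\partial\mathbb D$. For $x\in\partial\mathbb D$ let $\omega(x)$ be the set of all limits of subsequences of $(\varphi^n(x))_{n\ge 0}$, and for $J\subseteq\partial\mathbb D$ let $\omega(J)=\bigcup_{x\in J}\omega(x)$. A *wandering interval* of $\varphi$ is a nondegenerate interval $J\subseteq\partial\mathbb D$ (a connected subset with at least two points) such that $J,\varphi(J),\varphi^2(J),\dots$ are pairwise disjoint and $\omega(J)$ is not equal to a single periodic orbit of $\varphi$. If $\varphi$ has no wandering interval, then the weighted composition operator $$C_{w,\varphi}:C(\partial\mathbb D)\to C(\partial\mathbb D),\qquad C_{w,\varphi}f=w\cdot(f\circ\varphi),$$ on the space of continuous functions $\partial\mathbb D\to\mathbb C$ is not $\tau_p$-supercyclic: there is no $f\in C(\partial\mathbb D)$ such that $\{\lambda\, C_{w,\varphi}^n f:\lambda\in\mathbb C,\ n=0,1,2,\dots\}$ is dense in $C(\partial\mathbb D)$ for the topology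 $\tau_p$ of pointwise convergence on $\partial\mathbb D$. -/

import Mathlib

open Filter Topology

namespace WCO

/-- The topology `τ_p` of pointwise convergence on `C(X, ℂ)`: the topology induced by the
inclusion of `C(X, ℂ)` into the product `X → ℂ`. -/
noncomputable abbrev pointwiseTopology (X : Type*) [TopologicalSpace X] : TopologicalSpace C(X, ℂ) :=
  TopologicalSpace.induced (fun (f : C(X, ℂ)) (x : X) => f x) Pi.topologicalSpace

/-- The weighted composition operator `f ↦ w · (f ∘ φ)` on `C(X, ℂ)`. -/
noncomputable def weightedComp {X : Type*} [TopologicalSpace X] (w : C(X, ℂ)) (φ : C(X, X)) :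
    C(X, ℂ) →ₗ[ℂ] C(X, ℂ) where
  toFun f := w * f.comp φ
  map_add' f g := by ext x; simp [mul_add]
  map_smul' c f := by ext x; simp [mul_left_comm]

/-- `T` is `τ`-supercyclic: for some vector `f`, the set `{c Tⁿ f : c ∈ ℂ, n = 0, 1, 2, …}` is
dense with respect to the topology `τ`. -/
def IsSupercyclic {F : Type*} [AddCommGroup F] [Module ℂ F] (τ : TopologicalSpace F)
    (T : F →ₗ[ℂ] F) : Prop :=
  ∃ f : F, @Dense F τ {g : F | ∃ (c : ℂ) (n : ℕ), g = c • (T ^ n) f}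

/-- The `ω`-limit set of the orbit of a point `x`: all limits of subsequences of `φⁿ(x)`. -/
def omegaLimitPt {X : Type*} [TopologicalSpace X] (φ : X → X) (x : X) : Set X :=
  {y | ∃ n : ℕ → ℕ, StrictMono n ∧ Tendsto (fun k => φ^[n k] x) atTop (𝓝 y)}

/-- The `ω`-limit set of a set `J`: the union of the `ω`-limit sets of its points. (For an arc `J`
of the circle whose iterated images are pairwise disjoint, the diameters of these images tend to
zero, so all points of `J` have the same `ω`-limit set, and the union is this common set.) -/
def omegaLimitSet {X : Type*} [TopologicalSpace X] (φ : X → X) (J : Set X) : Set X :=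
  ⋃ x ∈ J, omegaLimitPt φ x

/-- `S` is a single periodic orbit `{p, φ(p), …, φⁿ⁻¹(p)}`, with `φⁿ(p) = p` for some `n ≥ 1`. -/
def IsPeriodicOrbit {X : Type*} (φ : X → X) (S : Set X) : Prop :=
  ∃ p ∈ Function.periodicPts φ, S = Set.range (fun n : ℕ => φ^[n] p)

/-- `J` is a wandering interval of the circle map `φ`: a nondegenerate interval of the circle
(that is, a connected subset with at least two points) such that `J, φ(J), φ²(J), …` are pairwise
disjoint and the `ω`-limit set of `J` is not a single periodic orbit. -/
structure IsWanderingInterval (φ : Circle → Circle) (J : Set Circle) : Prop where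
  connected : IsConnected J
  nontrivial : J.Nontrivial
  disjoint : Pairwise fun m n : ℕ => Disjoint (φ^[m] '' J) (φ^[n] '' J)
  not_periodic : ¬ IsPeriodicOrbit φ (omegaLimitSet φ J)

end WCO

namespace WCO

/-! ### Supercyclicity as interpolation of moduli along orbits -/

section Supercyclic

variable {X : Type*}

/-! Since `|w| = 1`, the modulus of `C^n f` at `x` is `|f (φ^n x)|`, so a supercyclic `f` lets the
scaled functions `r |f ∘ φ^n|` approximate any nonnegative data on finite sets
(`OrbitInterpolates`). This forces `φ` to be injective and to have no periodic points. Such a `φ`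
lifts to an increasing bijection of the line of degree one with irrational translation number `τ`.
Poincaré's theory gives a monotone semiconjugacy `F` to translation by `τ`. A nontrivial fibre of
`F` would project to a wandering interval, so `F` is a homeomorphism and `φ` is conjugate to a
rotation (`exists_orderIso_conj_translation`). In the conjugated coordinate the functions `|f ∘
φ^n|` are translates of one uniformly continuous function, too rigid to interpolate
(`not_interpolates_of_periodic`). -/

theorem norm_weightedComp_pow_apply [TopologicalSpace X] {w : C(X, ℂ)}
    (hw : ∀ z, ‖w z‖ = 1) (φ : C(X, X))
    (f : C(X, ℂ)) (n : ℕ) (x : X) : ‖((weightedComp w φ ^ n) f) x‖ = ‖f (φ^[n] x)‖ := by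
  induction n generalizing x with
  | zero => simp
  | succ n ih =>
    rw [pow_succ', Module.End.mul_apply, Function.iterate_succ_apply, ← ih]
    simp [weightedComp, hw]

/-- The scaled orbit of the modulus of `f` under `φ` interpolates arbitrary nonnegative data on
finite sets, up to arbitrarily small errors. -/
def OrbitInterpolates (φ : X → X) (f : X → ℂ) : Prop :=
  ∀ (S : Finset X) (h : X → ℝ), (∀ x, 0 ≤ h x) → ∀ ε > 0,
    ∃ r : ℝ, 0 ≤ r ∧ ∃ n : ℕ, ∀ x ∈ S, |r * ‖f (φ^[n] x)‖ - h x| < ε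

/-- Continuous functions on the circle interpolate arbitrary data on finite sets. -/
theorem exists_continuousMap_eqOn (S : Finset Circle) (h : Circle → ℂ) :
    ∃ g : C(Circle, ℂ), ∀ x ∈ S, g x = h x := by
  classical
  let P := Lagrange.interpolate S (fun x : Circle => (x : ℂ)) h
  refine ⟨⟨fun x => P.eval (x : ℂ), by fun_prop⟩, fun x hx => ?_⟩
  exact Lagrange.eval_interpolate_at_node h (Circle.coe_injective.injOn) hx

theorem IsSupercyclic.orbitInterpolates {φ : C(Circle, Circle)} {w : C(Circle, ℂ)}
    (hw : ∀ z, ‖w z‖ = 1) (h : IsSupercyclic (pointwiseTopology Circle) (weightedComp w φ)) :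
    ∃ f : C(Circle, ℂ), OrbitInterpolates φ f := by
  obtain ⟨f, hf⟩ := h
  refine ⟨f, fun S h hh ε hε => ?_⟩
  obtain ⟨g, hg⟩ := exists_continuousMap_eqOn S (fun x => (h x : ℂ))
  let V : Set (Circle → ℂ) := (S : Set Circle).pi fun x => Metric.ball (g x) ε
  have hV : IsOpen V := isOpen_set_pi S.finite_toSet fun _ _ => Metric.isOpen_ball
  let U : Set C(Circle, ℂ) := (fun (u : C(Circle, ℂ)) (x : Circle) => u x) ⁻¹' V
  have hU : IsOpen[pointwiseTopology Circle] U := ⟨V, hV, rfl⟩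
  have hgU : g ∈ U := fun x _ => Metric.mem_ball_self hε
  obtain ⟨u, huU, c, n, rfl⟩ :=
    (@dense_iff_inter_open _ (pointwiseTopology Circle) _).1 hf U hU ⟨g, hgU⟩
  refine ⟨‖c‖, norm_nonneg c, n, fun x hx => ?_⟩
  have h1 : ‖c * ((weightedComp w φ ^ n) f) x - g x‖ < ε := by
    simpa [dist_eq_norm] using huU x hx
  have h2 := (abs_norm_sub_norm_le (c * ((weightedComp w φ ^ n) f) x) (g x)).trans_lt h1
  rwa [norm_mul, norm_weightedComp_pow_apply hw, hg x hx, Complex.norm_real,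
    Real.norm_of_nonneg (hh x)] at h2

theorem OrbitInterpolates.exists_pair {φ : X → X} {f : X → ℂ} (h : OrbitInterpolates φ f) {a b : X}
    (hab : a ≠ b) {s t : ℝ} (hs : 0 ≤ s) (ht : 0 ≤ t) {ε : ℝ} (hε : 0 < ε) :
    ∃ r : ℝ, 0 ≤ r ∧ ∃ n : ℕ, |r * ‖f (φ^[n] a)‖ - s| < ε ∧ |r * ‖f (φ^[n] b)‖ - t| < ε := by
  classical
  obtain ⟨r, hr, n, hn⟩ := h {a, b} (fun x => if x = a then s else t)
    (fun x => by split_ifs <;> assumption) ε hε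
  refine ⟨r, hr, n, ?_, ?_⟩
  · simpa using hn a (by simp)
  · simpa [hab.symm] using hn b (by simp)

/-- Points with the same image have the same orbit from time 1 on, so the data 1 at `a` and 0 at `b`
can only be matched at `n = 0`. This gives `‖f b‖ < ‖f a‖`, and the roles of `a` and `b` can be
exchanged. -/
theorem OrbitInterpolates.injective {φ : X → X} {f : X → ℂ} (h : OrbitInterpolates φ f) :
    Function.Injective φ := by
  intro a b hab
  by_contra hne
  have key : ∀ {a b : X}, φ a = φ b → a ≠ b → ‖f b‖ < ‖f a‖ := by
    intro a b hab hne
    obtain ⟨r, hr, n, h1, h2⟩ := h.exists_pair hne zero_le_one le_rfl (ε := 1 / 3) (by norm_num)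
    rw [abs_lt] at h1 h2
    rcases n with _ | n
    · simp only [Function.iterate_zero, id_eq] at h1 h2
      by_contra hle
      have := mul_le_mul_of_nonneg_left (not_lt.1 hle) hr
      linarith [h1.1, h2.2]
    · rw [Function.iterate_succ_apply, hab] at h1
      rw [Function.iterate_succ_apply] at h2
      linarith [h1.1, h2.2]
  exact lt_asymm (key hab hne) (key hab.symm (Ne.symm hne))

/-- If `b` is periodic, then `‖f (φ^[n] b)‖` takes finitely many values, so that the ratios
`‖f (φ^[n] a)‖ / ‖f (φ^[n] b)‖` are bounded. -/
theorem OrbitInterpolates.notMem_periodicPts [TopologicalSpace X] [CompactSpace X]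
    [Nontrivial X] {φ : X → X}
    {f : C(X, ℂ)} (h : OrbitInterpolates φ f) (b : X) : b ∉ Function.periodicPts φ := by
  intro hb
  obtain ⟨a, hab⟩ := exists_ne b
  obtain ⟨δ, hδ, hδb⟩ : ∃ δ > 0, ∀ n, f (φ^[n] b) ≠ 0 → δ ≤ ‖f (φ^[n] b)‖ := by
    obtain ⟨p, hp, hpb⟩ := hb
    have hfin : (Set.range fun n => ‖f (φ^[n] b)‖).Finite := by
      refine ((Finset.range p).image fun n => ‖f (φ^[n] b)‖).finite_toSet.subset ?_
      rintro _ ⟨n, rfl⟩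
      simp only [Finset.coe_image, Finset.coe_range, Set.mem_image, Set.mem_Iio]
      exact ⟨n % p, Nat.mod_lt _ hp, by rw [hpb.iterate_mod_apply]⟩
    have hfin' := hfin.subset (Set.sdiff_subset (t := {0}))
    rcases (Set.range (fun n => ‖f (φ^[n] b)‖) \ {0}).eq_empty_or_nonempty with he | hne
    · refine ⟨1, one_pos, fun n hn => ?_⟩
      have : ‖f (φ^[n] b)‖ ∈ Set.range (fun n => ‖f (φ^[n] b)‖) \ {0} := ⟨⟨n, rfl⟩, by simpa⟩
      simp [he] at this
    · obtain ⟨δ, ⟨⟨m, rfl⟩, hm⟩, hmin⟩ := Set.exists_min_image _ id hfin' hne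
      refine ⟨‖f (φ^[m] b)‖, lt_of_le_of_ne (norm_nonneg _) (Ne.symm hm), fun n hn => ?_⟩
      exact hmin _ ⟨⟨n, rfl⟩, by simpa⟩
  have hM : ∀ x, ‖f x‖ ≤ ‖f‖ := f.norm_coe_le_norm
  -- The target 1 at `b` forces `r ≤ 2 / δ`, hence a value at most `2 * ‖f‖ / δ` at `a`; the target
  -- there exceeds this bound by more than the error.
  obtain ⟨r, hr, n, h1, h2⟩ := h.exists_pair hab (s := 2 * ‖f‖ / δ + 1) (t := 1) (by positivity)
    zero_le_one (ε := 1 / 2) (by norm_num)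
  rw [abs_lt] at h1 h2
  have hne : f (φ^[n] b) ≠ 0 := fun h0 => by
    rw [h0] at h2
    norm_num at h2
  have hrδ : r ≤ 2 / δ := by
    rw [le_div_iff₀ hδ]
    linarith [mul_le_mul_of_nonneg_left (hδb n hne) hr]
  have : r * ‖f (φ^[n] a)‖ ≤ 2 / δ * ‖f‖ := mul_le_mul hrδ (hM _) (norm_nonneg _) (by positivity)
  have h3 : 2 / δ * ‖f‖ = 2 * ‖f‖ / δ := by ring
  linarith [h1.1]

end Supercyclic

/-! ### Lifts to the line and their degree -/

section Lift

/-- The covering map `ℝ → 𝕋` of period `1`. -/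
noncomputable def circleCover (x : ℝ) : Circle := Circle.exp (2 * Real.pi * x)

theorem continuous_circleCover : Continuous circleCover := by
  unfold circleCover; fun_prop

theorem circleCover_eq_iff {x y : ℝ} : circleCover x = circleCover y ↔ ∃ m : ℤ, x = y + m := by
  rw [circleCover, circleCover, Circle.exp_eq_exp]
  refine exists_congr fun m => ?_
  constructor
  · intro h
    have : 2 * Real.pi * (x - (y + m)) = 0 := by linear_combination h
    have := (mul_eq_zero.1 this).resolve_left (by positivity)
    linarith
  · rintro rfl
    ring

theorem circleCover_add_int (x : ℝ) (m : ℤ) : circleCover (x + m) = circleCover x :=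
  circleCover_eq_iff.2 ⟨m, rfl⟩

theorem circleCover_surjective : Function.Surjective circleCover := fun z => by
  obtain ⟨t, rfl⟩ := Circle.exp_surjective z
  exact ⟨t / (2 * Real.pi), by rw [circleCover, mul_div_cancel₀ _ (by positivity)]⟩

theorem exists_lift (φ : C(Circle, Circle)) :
    ∃ g : ℝ → ℝ, Continuous g ∧ ∀ x, circleCover (g x) = φ (circleCover x) := by
  let ψ : C(ℝ, Circle) := φ.comp ⟨circleCover, continuous_circleCover⟩
  obtain ⟨t, ht⟩ := Circle.exp_surjective (ψ 0)
  obtain ⟨G, ⟨-, hG⟩, -⟩ := Circle.isCoveringMap_exp.existsUnique_continuousMap_lifts ψ 0 t ht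
  refine ⟨fun x => G x / (2 * Real.pi), by fun_prop, fun x => ?_⟩
  rw [circleCover, mul_div_cancel₀ _ (by positivity)]
  exact congrFun hG x

variable {φ : Circle → Circle} {g : ℝ → ℝ}

/-- The increment `g (x + 1) - g x` is continuous and integer-valued, hence constant. -/
theorem exists_degree (hg : Continuous g)
    (hφ : ∀ x, circleCover (g x) = φ (circleCover x)) :
    ∃ d : ℤ, ∀ (x : ℝ) (m : ℤ), g (x + m) = g x + m * d := by
  have h1 : ∀ x, ∃ k : ℤ, g (x + 1) = g x + k := fun x => by
    rw [← circleCover_eq_iff, hφ, hφ]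
    congr 1
    exact_mod_cast circleCover_add_int x 1
  choose k hk using h1
  have hkc : Continuous k := by
    rw [Int.isClosedEmbedding_coe_real.isInducing.continuous_iff]
    have : (fun x => ((k x : ℤ) : ℝ)) = fun x => g (x + 1) - g x := by
      ext x; rw [hk]; ring
    change Continuous fun x => ((k x : ℤ) : ℝ)
    rw [this]
    fun_prop
  refine ⟨k 0, fun x m => ?_⟩
  have hk' : ∀ x, g (x + 1) = g x + k 0 := fun x => by
    rw [hk, PreconnectedSpace.constant inferInstance hkc]
  induction m with
  | zero => simp
  | succ i ih =>
    have := hk' (x + i)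
    push_cast at ih ⊢
    rw [← add_assoc, this, ih]; ring
  | pred i ih =>
    have := hk' (x + (-i - 1))
    push_cast at ih ⊢
    rw [show x + (-(i : ℝ) - 1) + 1 = x + -i by ring, ih] at this
    linarith

/-- A lift of an injective circle map is injective and has degree `1` or `-1`. -/
theorem injective_lift_and_degree (hinj : Function.Injective φ) (hg : Continuous g)
    (hφ : ∀ x, circleCover (g x) = φ (circleCover x)) :
    Function.Injective g ∧
      ((∀ x, g (x + 1) = g x + 1) ∨ (∀ x, g (x + 1) = g x - 1)) := by
  obtain ⟨d, hd⟩ := exists_degree hg hφ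
  have hint : ∀ {x y : ℝ} {k : ℤ}, g x = g y + k → ∃ m : ℤ, x = y + m := fun {x y k} h => by
    rw [← circleCover_eq_iff]
    apply hinj
    rw [← hφ, ← hφ, circleCover_eq_iff]
    exact ⟨k, h⟩
  have hint0 : ∀ {x y : ℝ}, g x = g y → ∃ m : ℤ, x = y + m := fun {x y} h =>
    hint (k := 0) (by simpa using h)
  -- In degree 0, `g 0 = g 1`, so the value midway between `g 0` and `g (1 / 2)` is taken on both
  -- halves of the period, against injectivity of `φ`.
  have hd0 : d ≠ 0 := by
    rintro rfl
    have h01 : g 1 = g 0 := by simpa using hd 0 1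
    set v := (g 0 + g (1 / 2)) / 2 with hv
    have hne : g (1 / 2) ≠ g 0 := fun h => by
      obtain ⟨m, hm⟩ := hint0 h
      have h1 : (0 : ℝ) < m := by linarith
      have h2 : (m : ℝ) < 1 := by linarith
      norm_cast at h1 h2
      omega
    have hv1 : v ∈ Set.uIcc (g 0) (g (1 / 2)) := by
      rw [Set.mem_uIcc]
      rcases le_total (g 0) (g (1 / 2)) with h | h
      · left; constructor <;> linarith
      · right; constructor <;> linarith
    obtain ⟨x, hx, hxv⟩ := intermediate_value_uIcc (a := 0) (b := 1 / 2) hg.continuousOn hv1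
    obtain ⟨y, hy, hyv⟩ := intermediate_value_uIcc (a := 1) (b := 1 / 2) hg.continuousOn
      (by rwa [h01] : v ∈ Set.uIcc (g 1) (g (1 / 2)))
    rw [Set.uIcc_of_le (by norm_num)] at hx
    rw [Set.uIcc_of_ge (by norm_num)] at hy
    have hx2 : x ≠ 1 / 2 := by
      rintro rfl
      apply hne; linarith
    have hx0 : x ≠ 0 := by
      rintro rfl
      apply hne; linarith
    have hy2 : y ≠ 1 := by
      rintro rfl
      apply hne; linarith
    obtain ⟨m, hm⟩ := hint0 (hyv.trans hxv.symm)
    have hx2' := lt_of_le_of_ne hx.2 hx2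
    have hx0' := lt_of_le_of_ne hx.1 hx0.symm
    have hy2' := lt_of_le_of_ne hy.2 hy2
    have h1 : (0 : ℝ) < m := by linarith [hy.1]
    have h2 : (m : ℝ) < 1 := by linarith
    norm_cast at h1 h2
    omega
  constructor
  · intro x y hxy
    obtain ⟨m, rfl⟩ := hint0 hxy
    rw [hd] at hxy
    have : (m : ℝ) * d = 0 := by linarith
    have hm := (mul_eq_zero.1 this).resolve_right (by exact_mod_cast hd0)
    simp [hm]
  · have hd' : (1 : ℝ) ≤ |(d : ℝ)| := by
      exact_mod_cast Int.one_le_abs hd0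
    -- Injectivity modulo integers makes such an `x` an integer `m`, and then `m * d = 1`.
    obtain ⟨x, hx⟩ : ∃ x, g x = g 0 + 1 := by
      have h1 := hd 0 1
      have h2 := hd 0 (-1)
      rcases abs_cases (d : ℝ) with ⟨h, -⟩ | ⟨h, -⟩
      · exact mem_range_of_exists_le_of_exists_ge hg ⟨0, by linarith⟩
          ⟨0 + (1 : ℤ), by rw [h1]; push_cast; linarith⟩
      · exact mem_range_of_exists_le_of_exists_ge hg ⟨0, by linarith⟩
          ⟨0 + (-1 : ℤ), by rw [h2]; push_cast; linarith⟩
    obtain ⟨m, rfl⟩ := hint (k := 1) (by simpa using hx)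
    rw [hd] at hx
    have hmd : m * d = 1 := by
      have : (m : ℝ) * d = 1 := by linarith
      exact_mod_cast this
    rcases Int.isUnit_iff.1 (IsUnit.of_mul_eq_one_right m hmd) with rfl | rfl
    · left; intro x; simpa using hd x 1
    · right; intro x; simpa [sub_eq_add_neg] using hd x 1

/-- An orientation-reversing circle map has a fixed point. -/
theorem exists_isFixedPt_of_degree_neg_one (hg : Continuous g)
    (hφ : ∀ x, circleCover (g x) = φ (circleCover x)) (hd : ∀ x, g (x + 1) = g x - 1) :
    ∃ z, Function.IsFixedPt φ z := by
  have h1 : g 1 = g 0 - 1 := by simpa using hd 0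
  -- `g x - x` drops by 2 on `[0, 1]`, so it meets an integer.
  obtain ⟨x, hx⟩ : ∃ x, g x - x = ⌊g 0⌋ :=
    mem_range_of_exists_le_of_exists_ge (f := fun x => g x - x) (by fun_prop)
      ⟨1, by rw [h1]; linarith [Int.lt_floor_add_one (g 0)]⟩
      ⟨0, by linarith [Int.floor_le (g 0)]⟩
  refine ⟨circleCover x, ?_⟩
  rw [Function.IsFixedPt, ← hφ, circleCover_eq_iff]
  exact ⟨⌊g 0⌋, by linarith⟩

/-- An injective circle map without periodic points lifts to a strictly increasing homeomorphism
of the line of degree one. -/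
theorem exists_circleDeg1Lift (φ : C(Circle, Circle)) (hinj : Function.Injective φ)
    (hper : ∀ z, z ∉ Function.periodicPts φ) :
    ∃ f : CircleDeg1Lift, Continuous f ∧ Function.Bijective f ∧
      ∀ x, circleCover (f x) = φ (circleCover x) := by
  obtain ⟨g, hg, hφ⟩ := exists_lift φ
  obtain ⟨hgi, hd | hd⟩ := injective_lift_and_degree hinj hg hφ
  · rcases hg.strictMono_of_inj hgi with hm | hm
    · let f : CircleDeg1Lift := ⟨⟨g, hm.monotone⟩, hd⟩
      exact ⟨f, hg, ⟨hgi, f.continuous_iff_surjective.1 hg⟩, hφ⟩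
    · have h1 := hm (zero_lt_one (α := ℝ))
      have h2 : g 1 = g 0 + 1 := by simpa using hd 0
      linarith
  · obtain ⟨z, hz⟩ := exists_isFixedPt_of_degree_neg_one hg hφ hd
    exact absurd (Function.mk_mem_periodicPts one_pos (hz.isPeriodicPt 1)) (hper z)

end Lift

/-! ### Conjugacy to an irrational rotation -/

section Conjugacy

variable {φ : Circle → Circle} {f : CircleDeg1Lift}

theorem circleCover_iterate (hφ : ∀ x, circleCover (f x) = φ (circleCover x)) (n : ℕ) (x : ℝ) :
    circleCover (f^[n] x) = φ^[n] (circleCover x) :=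
  (Function.Semiconj.iterate_right (f := circleCover) (ga := f) (gb := φ) hφ n) x

theorem irrational_translationNumber (hf : Continuous f)
    (hφ : ∀ x, circleCover (f x) = φ (circleCover x))
    (hper : ∀ z, z ∉ Function.periodicPts φ) : Irrational f.translationNumber := by
  rintro ⟨q, hq⟩
  have hτ : f.translationNumber = (q.num : ℝ) / (q.den : ℕ) := by
    rw [← hq]; exact_mod_cast (Rat.num_div_den q).symm
  obtain ⟨x, hx⟩ := (f.translationNumber_eq_rat_iff hf q.den_pos).1 hτ
  refine hper (circleCover x) (Function.mk_mem_periodicPts q.den_pos ?_)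
  rw [Function.IsPeriodicPt, Function.IsFixedPt, ← circleCover_iterate hφ, circleCover_eq_iff]
  exact ⟨q.num, by rw [← hx, CircleDeg1Lift.coe_pow]⟩

theorem iterate_semiconj {F : CircleDeg1Lift} {τ : ℝ} (hF : ∀ x, F (f x) = F x + τ) (n : ℕ)
    (x : ℝ) : F (f^[n] x) = F x + n * τ := by
  induction n with
  | zero => simp
  | succ n ih => rw [Function.iterate_succ_apply', hF, ih]; push_cast; ring

/-- The range of `F` is invariant under translation by `τ` and by 1, hence contains a coset of a
dense subgroup. A monotone map with dense range has no jumps. -/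
theorem surjective_of_semiconj {F : CircleDeg1Lift} {τ : ℝ} (hτ : Irrational τ)
    (hf : Function.Surjective f) (hF : ∀ x, F (f x) = F x + τ) : Function.Surjective F := by
  have hmem : ∀ t ∈ AddSubgroup.closure {τ, (1 : ℝ)}, ∀ s, s ∈ Set.range F ↔ s + t ∈ Set.range F := by
    intro t ht
    induction ht using AddSubgroup.closure_induction with
    | mem t ht =>
      intro s
      rcases ht with rfl | rfl
      · constructor
        · rintro ⟨x, rfl⟩
          exact ⟨f x, hF x⟩
        · rintro ⟨x, hx⟩
          obtain ⟨y, rfl⟩ := hf x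
          exact ⟨y, by linarith [hF y]⟩
      · constructor
        · rintro ⟨x, rfl⟩
          exact ⟨x + 1, F.map_add_one x⟩
        · rintro ⟨x, hx⟩
          refine ⟨x - 1, ?_⟩
          have := F.map_add_one (x - 1)
          rw [sub_add_cancel] at this
          linarith
    | zero => simp
    | add a b _ _ ha hb => intro s; rw [ha, hb, add_assoc]
    | neg a _ ha => intro s; rw [ha (s + -a), neg_add_cancel_right]
  have hdense : Dense (AddSubgroup.closure {τ, (1 : ℝ)} : Set ℝ) :=
    dense_addSubgroupClosure_pair_iff.2 (by simpa using hτ)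
  have hrange : DenseRange F := by
    have h1 : Dense ((fun t => F 0 + t) '' (AddSubgroup.closure {τ, (1 : ℝ)} : Set ℝ)) :=
      (Homeomorph.addLeft (F 0)).surjective.denseRange.dense_image (by fun_prop) hdense
    refine h1.mono ?_
    rintro _ ⟨t, ht, rfl⟩
    exact (hmem t ht _).1 ⟨0, rfl⟩
  exact F.continuous_iff_surjective.1 (F.monotone.continuous_of_denseRange hrange)

/-- A nontrivial fibre of a semiconjugacy to an irrational translation is a wandering interval. -/
theorem isWanderingInterval_of_semiconj {F : CircleDeg1Lift} {τ : ℝ} (hτ : Irrational τ)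
    (hφ : ∀ x, circleCover (f x) = φ (circleCover x))
    (hper : ∀ z, z ∉ Function.periodicPts φ) (hF : ∀ x, F (f x) = F x + τ) {a b : ℝ}
    (hab : a < b) (hFab : F a = F b) : IsWanderingInterval φ (circleCover '' Set.Icc a b) where
  connected := (isConnected_Icc hab.le).image _ continuous_circleCover.continuousOn
  nontrivial := by
    refine ⟨_, ⟨a, Set.left_mem_Icc.2 hab.le, rfl⟩, _, ⟨b, Set.right_mem_Icc.2 hab.le, rfl⟩, ?_⟩
    intro h
    obtain ⟨m, rfl⟩ := circleCover_eq_iff.1 h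
    rw [F.map_add_int] at hFab
    have : (m : ℝ) = 0 := by linarith
    linarith
  disjoint := by
    have hconst : ∀ x ∈ Set.Icc a b, F x = F a := fun x hx =>
      le_antisymm (hFab ▸ F.monotone hx.2) (F.monotone hx.1)
    intro m n hmn
    rw [Set.disjoint_left]
    rintro _ ⟨_, ⟨x, hx, rfl⟩, rfl⟩ ⟨_, ⟨y, hy, rfl⟩, hxy⟩
    rw [← circleCover_iterate hφ, ← circleCover_iterate hφ, circleCover_eq_iff] at hxy
    obtain ⟨k, hk⟩ := hxy
    have h1 := congrArg F hk
    rw [F.map_add_int, iterate_semiconj hF, iterate_semiconj hF, hconst x hx, hconst y hy] at h1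
    -- As `F` is constant on `[a, b]`, an intersection would make `(n - m) * τ` an integer.
    have hne : ((n : ℤ) - m) ≠ 0 := by omega
    refine (hτ.intCast_mul hne).ne_int k ?_
    push_cast
    linarith
  not_periodic := by
    -- There are no periodic orbits at all, so the limit set needs no analysis.
    rintro ⟨p, hp, -⟩
    exact hper p hp

/-- A circle map without periodic points and wandering intervals whose lift is bijective is
conjugate to an irrational rotation. -/
theorem exists_orderIso_conj_translation (hf : Continuous f) (hfb : Function.Bijective f)
    (hφ : ∀ x, circleCover (f x) = φ (circleCover x))
    (hper : ∀ z, z ∉ Function.periodicPts φ)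
    (hw : ¬ ∃ J : Set Circle, IsWanderingInterval φ J) :
    ∃ (F : ℝ ≃o ℝ) (τ : ℝ), (∀ x, F (x + 1) = F x + 1) ∧ ∀ (n : ℕ) x, F (f^[n] x) = F x + n * τ := by
  have hτ := irrational_translationNumber hf hφ hper
  set τ := f.translationNumber
  -- Equal translation numbers give only a monotone `F`; injectivity comes from `hw`, surjectivity
  -- from irrationality.
  obtain ⟨F, hF⟩ := CircleDeg1Lift.semiconj_of_bijective_of_translationNumber_eq hfb
    (f₂ := CircleDeg1Lift.translate (Multiplicative.ofAdd τ))
    (CircleDeg1Lift.isUnit_iff_bijective.1 (Units.isUnit _))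
    (CircleDeg1Lift.translationNumber_translate τ).symm
  have hF' : ∀ x, F (f x) = F x + τ := fun x => by
    rw [hF.eq, CircleDeg1Lift.translate_apply, add_comm]
  have hinj : Function.Injective F := by
    intro a b hab
    by_contra hne
    rcases lt_or_gt_of_ne hne with h | h
    · exact hw ⟨_, isWanderingInterval_of_semiconj hτ hφ hper hF' h hab⟩
    · exact hw ⟨_, isWanderingInterval_of_semiconj hτ hφ hper hF' h hab.symm⟩
  exact ⟨(F.strictMono_iff_injective.2 hinj).orderIsoOfSurjective F
    (surjective_of_semiconj hτ hfb.2 hF'), τ, F.map_add_one, iterate_semiconj hF'⟩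

end Conjugacy

/-! ### Rotations do not interpolate -/

section Rotation

/-- `G` factors through the compact group `ℝ / ℤ`. -/
theorem uniformContinuous_of_periodic {G : ℝ → ℝ} (hG : Continuous G)
    (hper : Function.Periodic G 1) : UniformContinuous G := by
  have hlift : Continuous hper.lift := continuous_coinduced_dom.2 hG
  exact (CompactSpace.uniformContinuous_of_continuous hlift).comp
    (uniformContinuous_addMonoidHom_of_continuous
      (f := QuotientAddGroup.mk' (AddSubgroup.zmultiples (1 : ℝ))) continuous_quotient_mk')

/-- The translates of a nonzero nonnegative continuous periodic function do not interpolate up to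
scaling: they cannot be close to `1` on a fine grid and small at a point between grid points. -/
theorem not_interpolates_of_periodic {G : ℝ → ℝ} (hG : Continuous G)
    (hper : Function.Periodic G 1) (hpos : ∀ x, 0 ≤ G x) {y₀ : ℝ} (hy₀ : G y₀ ≠ 0) :
    ∃ N : ℕ, 0 < N ∧ ∀ r s : ℝ, 0 ≤ r → (∀ i < N, |r * G (i / N + s) - 1| < 1 / 8) →
      ¬ |r * G (1 / (2 * N) + s)| < 1 / 8 := by
  set M := G y₀ with hM
  have hMpos : 0 < M := lt_of_le_of_ne (hpos _) (Ne.symm hy₀)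
  -- Some grid point has `G ≥ 3M/4`, so `r * M < 3/2`. The off-grid point differs from grid point 0
  -- by at most `M/4` in `G`, so its scaled value exceeds `7/8 - 3/8 = 1/2`.
  obtain ⟨δ, hδ, hδG⟩ := Metric.uniformContinuous_iff.1 (uniformContinuous_of_periodic hG hper)
    (M / 4) (by positivity)
  obtain ⟨k, hk⟩ := exists_nat_one_div_lt hδ
  set N := k + 1 with hN
  have hN0 : (0 : ℝ) < N := by positivity
  have hNδ : 1 / (N : ℝ) < δ := by rw [hN]; push_cast; exact hk
  refine ⟨N, k.succ_pos, fun r s hr h1 h2 => ?_⟩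
  set u := Int.fract (y₀ - s) with hu
  have hu0 : 0 ≤ u := Int.fract_nonneg _
  have hu1 : u < 1 := Int.fract_lt_one _
  have hGu : G (u + s) = M := by
    have : u + s = y₀ - ⌊y₀ - s⌋ * 1 := by
      rw [hu, ← Int.self_sub_floor]; ring
    rw [this, hper.sub_int_mul_eq]
  set i := ⌊u * N⌋₊ with hi
  have hi1 : (i : ℝ) ≤ u * N := Nat.floor_le (by positivity)
  have hi2 : u * N < i + 1 := Nat.lt_floor_add_one _
  have hiN : i < N := by
    have : (i : ℝ) < N := by nlinarith
    exact_mod_cast this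
  have hd1 : dist (i / N + s) (u + s) < δ := by
    rw [dist_add_right, Real.dist_eq, abs_lt]
    have e1 : (i : ℝ) / N ≤ u := by rwa [div_le_iff₀ hN0]
    have e2 : u < i / N + 1 / N := by rwa [← add_div, lt_div_iff₀ hN0]
    constructor <;> linarith
  have hd2 : dist (1 / (2 * N) + s) (((0 : ℕ) : ℝ) / N + s) < δ := by
    have e1 : (1 : ℝ) / (2 * N) = (1 / N) / 2 := by field_simp
    have e2 : (0 : ℝ) < 1 / N := by positivity
    rw [dist_add_right, Real.dist_eq, abs_lt, e1]
    rw [Nat.cast_zero, zero_div]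
    constructor <;> linarith
  have g1 := hδG hd1
  have g2 := hδG hd2
  have a1 := h1 i hiN
  have a2 := h1 0 k.succ_pos
  rw [Real.dist_eq, hGu] at g1
  rw [Real.dist_eq] at g2
  rw [abs_lt] at g1 g2 a1 a2 h2
  have b1 : r * (3 * M / 4) ≤ r * G (i / N + s) := mul_le_mul_of_nonneg_left (by linarith) hr
  have b2 : r * (G (((0 : ℕ) : ℝ) / N + s) - M / 4) ≤ r * G (1 / (2 * N) + s) :=
    mul_le_mul_of_nonneg_left (by linarith) hr
  linarith [mul_sub r (G (((0 : ℕ) : ℝ) / N + s)) (M / 4)]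

end Rotation

/-- Conjugates of rotations do not interpolate. -/
theorem not_orbitInterpolates_of_conj {φ : Circle → Circle} {f : CircleDeg1Lift} {F : ℝ ≃o ℝ}
    {τ : ℝ} (hφ : ∀ x, circleCover (f x) = φ (circleCover x)) (hF1 : ∀ x, F (x + 1) = F x + 1)
    (hF : ∀ (n : ℕ) x, F (f^[n] x) = F x + n * τ) (u : C(Circle, ℂ)) :
    ¬ OrbitInterpolates φ u := by
  classical
  intro h
  have hu : ∃ z, u z ≠ 0 := by
    by_contra! h0
    obtain ⟨r, -, n, hn⟩ := h {1} (fun _ => 1) (fun _ => zero_le_one) 1 one_pos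
    have := hn 1 (by simp)
    simp [h0] at this
  obtain ⟨z, hz⟩ := hu
  obtain ⟨x₀, rfl⟩ := circleCover_surjective z
  let G : ℝ → ℝ := fun y => ‖u (circleCover (F.symm y))‖
  have hG : Continuous G :=
    (u.continuous.comp (continuous_circleCover.comp F.symm.continuous)).norm
  have hsymm : ∀ y (m : ℤ), F.symm (y + m) = F.symm y + m := fun y m => by
    let F' : CircleDeg1Lift := ⟨⟨F, F.monotone⟩, hF1⟩
    rw [F.symm_apply_eq]
    exact (by rw [F.apply_symm_apply] : y + m = F (F.symm y) + m).trans
      (F'.map_add_int (F.symm y) m).symm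
  have hper : Function.Periodic G 1 := fun y => by
    have := hsymm y 1
    simp only [G]
    rw [Int.cast_one] at this
    rw [this]
    congr 2
    exact_mod_cast circleCover_add_int (F.symm y) 1
  have horbit : ∀ n y, ‖u (φ^[n] (circleCover (F.symm y)))‖ = G (y + n * τ) := fun n y => by
    simp only [G]
    rw [← circleCover_iterate hφ, ← F.apply_symm_apply y, ← hF, F.symm_apply_apply,
      F.symm_apply_apply]
  obtain ⟨N, hN, hcontra⟩ := not_interpolates_of_periodic hG hper (fun _ => norm_nonneg _)
    (y₀ := F x₀) (by simpa [G] using hz)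
  let P : ℝ → Circle := fun y => circleCover (F.symm y)
  obtain ⟨r, hr, n, hn⟩ := h (insert (P (1 / (2 * N))) ((Finset.range N).image fun i : ℕ => P (i / N)))
    (fun x => if x = P (1 / (2 * N)) then 0 else 1)
    (fun x => by split_ifs <;> simp) (1 / 8) (by norm_num)
  refine hcontra r (n * τ) hr (fun i hi => ?_) ?_
  · have h1 := hn (P (i / N)) (by
      rw [Finset.mem_insert, Finset.mem_image]
      exact Or.inr ⟨i, Finset.mem_range.2 hi, rfl⟩)
    rw [if_neg, horbit] at h1
    · exact h1
    -- The half-step point is not a grid point modulo 1, by parity.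
    · intro heq
      obtain ⟨m, hm⟩ := circleCover_eq_iff.1 heq
      rw [← hsymm, F.symm.injective.eq_iff] at hm
      have hN0 : (0 : ℝ) < N := by exact_mod_cast hN
      have h2 : (2 * i : ℝ) = 1 + 2 * m * N := by
        field_simp at hm
        linarith
      have h3 : (2 * i : ℤ) = 1 + 2 * m * N := by exact_mod_cast h2
      rw [mul_assoc] at h3
      omega
  · have h1 := hn (P (1 / (2 * N))) (Finset.mem_insert_self _ _)
    rw [if_pos rfl, horbit, sub_zero] at h1
    exact h1

end WCO

theorem theorem4p12 (φ : C(Circle, Circle)) (w : C(Circle, ℂ))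
    (hφ : ¬ ∃ J : Set Circle, WCO.IsWanderingInterval φ J)
    (hw : ∀ z : Circle, ‖w z‖ = 1) :
    ¬ WCO.IsSupercyclic (WCO.pointwiseTopology Circle) (WCO.weightedComp w φ) := by
  intro h
  obtain ⟨u, hu⟩ := h.orbitInterpolates hw
  have : Nontrivial Circle := ⟨1, Circle.exp Real.pi, fun h => by
    have h' := congrArg (fun z : Circle => (z : ℂ)) h
    norm_num [Circle.coe_exp, Complex.exp_pi_mul_I] at h'⟩
  have hper := hu.notMem_periodicPts
  obtain ⟨f, hf, hfb, hlift⟩ := WCO.exists_circleDeg1Lift φ hu.injective hper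
  obtain ⟨F, τ, hF1, hF⟩ := WCO.exists_orderIso_conj_translation hf hfb hlift hper hφ
  exact WCO.not_orbitInterpolates_of_conj hlift hF1 hF u hu
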